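/- Let $\mathbb F$ be a field, let $n,k$ be non-negative integers with $n\ge k+2$, and let $M_{n\times k}(\mathbb F)$ be the space of $n\times k$ matrices over $\mathbb F$. The Cullis determinant of $X\in M_{n\times k}(\mathbb F)$ is $$\det\nolimits_{n,k}(X)=\sum_{\sigma}\operatorname{sgn}(\pi_\sigma)\,(-1)^{\sum_{\alpha=1}^{k}(i_\alpha-\alpha)}\,X_{\sigma(1)\,1}X_{\sigma(2)\,2}\cdots X_{\sigma(k)\,k},$$ where $\sigma$ runs over all injections $\{1,\dots,k\}\to\{1,\dots,n\}$, $\{i_1<\dots<i_k\}$ is the image of $\sigma$, and $\pi_\sigma$ is the permutation $i_\alpha\mapsto\sigma(\alpha)$ of this image. A linear variety is a set $K=A+V\subseteq M_{n\times k}(\mathbb F)$ with $A$ a matrix and $V$ a linear subspace; $\dim K=\dim V$ and $\operatorname{codim}K=nk-\dim V$. Let $$L=\Bigl\{X\in M_{n\times k}(\mathbb F):\ \sum_{i=1}^{n}(-1)^iX_{i\,j}=0\ \text{ for all } 1\le j\le k\Bigr\}$$ be the space of matrices whose alternating row sum is zero. (1) Let $K\subseteq M_{n\times k}(\mathbb F)$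 be a linear variety. Then $\det_{n,k}(X)=0$ for all $X\in K$ and $\operatorname{codim}K=k$ if and only if $k$ is odd and $K=L$. (2) If $k$ is odd, then $L$ is the unique linear variety of maximal dimension among the linear varieties in $M_{n\times k}(\mathbb F)$ on which $\det_{n,k}$ vanishes. (3) If $k$ is even, then every linear variety in $M_{n\times k}(\mathbb F)$ on which $\det_{n,k}$ vanishes has codimension strictly greater than $k$; in particular none of codimension $k$ exists. -/

import Mathlib

namespace Cullis

/-- The image `σ([k])` of an injection `σ : [k] → [n]`. -/
def image {n k : ℕ} (σ : Fin k ↪ Fin n) : Finset (Fin n) :=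
  Finset.univ.map σ

theorem card_image {n k : ℕ} (σ : Fin k ↪ Fin n) : (image σ).card = k := by
  simp [image]

/-- The sign `(-1) ^ ∑ α, (c(α) - α)` of a `k`-element subset `c` of `[n]`, where `c(α)` is the
`α`-th smallest element of `c`. (Counting rows and positions from `0` instead of `1` does not
change the differences.) -/
def setSign {n k : ℕ} (c : Finset (Fin n)) (h : c.card = k) : ℤˣ :=
  (-1) ^ (∑ α : Fin k, (((c.orderEmbOfFin h α : Fin n) : ℕ) - ((α : ℕ) : ℤ) : ℤ))

/-- An injection `σ`, seen as a bijection of `[k]` onto its image. -/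
noncomputable def toImage {n k : ℕ} (σ : Fin k ↪ Fin n) : Fin k ≃ image σ :=
  Equiv.ofBijective (fun α => ⟨σ α, Finset.mem_map_of_mem σ (Finset.mem_univ α)⟩) (by
    constructor
    · intro a b hab
      exact σ.injective (congrArg Subtype.val hab)
    · rintro ⟨x, hx⟩
      obtain ⟨a, -, ha⟩ := Finset.mem_map.mp hx
      exact ⟨a, Subtype.ext ha⟩)

/-- The permutation `i_α ↦ σ(α)` of `σ([k]) = {i_1 < ⋯ < i_k}`. -/
noncomputable def imagePerm {n k : ℕ} (σ : Fin k ↪ Fin n) : Equiv.Perm (image σ) :=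
  ((image σ).orderIsoOfFin (card_image σ)).symm.toEquiv.trans (toImage σ)

/-- The sign of an injection: the sign of `i_α ↦ σ(α)` times the sign of the set `σ([k])`. -/
noncomputable def injSign {n k : ℕ} (σ : Fin k ↪ Fin n) : ℤˣ :=
  Equiv.Perm.sign (imagePerm σ) * setSign (image σ) (card_image σ)

/-- The Cullis determinant of an `n × k` matrix (used for `k ≤ n`):
`∑_σ sgn(σ) X_{σ(1),1} ⋯ X_{σ(k),k}` over all injections `σ : [k] → [n]`. -/
noncomputable def det {F : Type*} [Field F] {n k : ℕ} (X : Matrix (Fin n) (Fin k) F) : F :=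
  ∑ σ : Fin k ↪ Fin n, ((injSign σ : ℤ) : F) * ∏ j : Fin k, X (σ j) j

/-- The alternating row sum `∑_{i=1}^n (-1)^i X[i|)`; row number `i` is indexed by `i - 1`. -/
def altRowSum {F : Type*} [Field F] {n k : ℕ} (X : Matrix (Fin n) (Fin k) F) : Fin k → F :=
  ∑ i : Fin n, (-1 : F) ^ ((i : ℕ) + 1) • X i

/-- The space of all `n × k` matrices whose alternating row sum is zero. -/
def altRowSumZero (F : Type*) [Field F] (n k : ℕ) : Submodule F (Matrix (Fin n) (Fin k) F) where
  carrier := {X | altRowSum X = 0}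
  zero_mem' := by
    ext j
    simp [altRowSum]
  add_mem' := by
    intro X Y hX hY
    have h : altRowSum (X + Y) = altRowSum X + altRowSum Y := by
      ext j
      simp [altRowSum, mul_add, Finset.sum_add_distrib]
    simp only [Set.mem_ofPred_eq] at hX hY ⊢
    rw [h, hX, hY, add_zero]
  smul_mem' := by
    intro a X hX
    have h : altRowSum (a • X) = a • altRowSum X := by
      ext j
      simp [altRowSum, Finset.mul_sum, mul_left_comm]
    simp only [Set.mem_ofPred_eq] at hX ⊢
    rw [h, hX, smul_zero]

/-- The dimension of a linear variety `K = A + V`, i.e. `dim V`. -/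
noncomputable def dim {F : Type*} [Field F] {n k : ℕ}
    (K : AffineSubspace F (Matrix (Fin n) (Fin k) F)) : ℕ :=
  Module.finrank F K.direction

/-- The codimension `n * k - dim K` of a linear variety of `n × k` matrices. -/
noncomputable def codim {F : Type*} [Field F] {n k : ℕ}
    (K : AffineSubspace F (Matrix (Fin n) (Fin k) F)) : ℕ :=
  n * k - dim K

/-- `K` is a linear variety (a translate `A + V` of a linear subspace, that is, a nonempty affine
subspace) on which the Cullis determinant vanishes. -/
def IsAnnihilating {F : Type*} [Field F] {n k : ℕ}
    (K : AffineSubspace F (Matrix (Fin n) (Fin k) F)) : Prop :=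
  (K : Set (Matrix (Fin n) (Fin k) F)).Nonempty ∧ ∀ X ∈ K, det X = 0

/-- `K` has maximal dimension among the linear varieties annihilating the Cullis determinant. -/
def IsMaxAnnihilating {F : Type*} [Field F] {n k : ℕ}
    (K : AffineSubspace F (Matrix (Fin n) (Fin k) F)) : Prop :=
  IsAnnihilating K ∧
    ∀ K' : AffineSubspace F (Matrix (Fin n) (Fin k) F), IsAnnihilating K' → dim K' ≤ dim K

end Cullis

/-! Multiplying row `i` by `(-1)^i` turns the Cullis determinant, up to sign, into the sum of all
maximal minors, an alternating form E_k of the k columns. It turns L into the tuples whose columns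
lie in the kernel of ℓ, the sum of entries. For even k these forms satisfy E_{k+1} = ℓ ∧ E_k and
E_{k+2}(u, ·) = ω(u, ·) ∧ E_k with ω = `signForm`, so the even ones are Pfaffians of ω. The
recursions involve no division and hold in every characteristic. The first shows at once that the
determinant vanishes on L when k is odd.

The dimension bounds use only the recursions and the rank of ω, and go by induction in steps of two
over all finite-dimensional spaces. Suppose ℓ ∧ E_k vanishes on A + V of codimension at most k + 1,
at some point of which ℓ is not identically zero. Column operations make its ℓ-values (1, 0, …, 0);
slicing by ker ℓ and applying the bound for E_k there forces equality in every dimension count.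
Varying the base point then gives V = everything, a contradiction (`odd_bound`).

If E_{k+2} vanishes on A + V of codimension at most k + 2, the directions u available in the first
entry make ω(u, ·) ∧ E_k vanish on the tails. Then `odd_bound` makes tails and directions orthogonal
under ω, which is too restrictive unless every u is available. Hence V is everything and E_{k+2} =
0, again impossible (`even_bound`). The condition n ≥ k + 2 supplies the required ranks. -/

open Module

namespace Cullis

/-! ### Dimension counts and column operations -/

section LinearAlgebra

variable {F : Type*} [Field F]

/-- If `i` identifies `U` with the kernel of `f`, then the dimension of a subspace splits. -/
theorem finrank_comap_add_finrank_map {U M N : Type*} [AddCommGroup U] [Module F U]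
    [AddCommGroup M] [Module F M] [FiniteDimensional F M] [AddCommGroup N] [Module F N]
    (i : U →ₗ[F] M) (f : M →ₗ[F] N) (hi : Function.Injective i)
    (h : LinearMap.range i = LinearMap.ker f) (V : Submodule F M) :
    finrank F (V.comap i) + finrank F (V.map f) = finrank F V := by
  have h₁ := (f.domRestrict V).finrank_range_add_finrank_ker
  have h₂ : LinearMap.range (f.domRestrict V) = V.map f := LinearMap.range_domRestrict V f
  have h₃ : finrank F (LinearMap.ker (f.domRestrict V)) = finrank F (V.comap i) := by
    rw [LinearEquiv.finrank_eq (Submodule.equivMapOfInjective i hi (V.comap i)),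
      ← Submodule.finrank_map_subtype_eq, LinearMap.ker_domRestrict, Submodule.map_comap_eq,
      Submodule.range_subtype, Submodule.map_comap_eq, h, inf_comm]
  rw [h₂, h₃] at h₁
  omega

/-- The quotient of M by U surjects onto the quotient of the range by the image of U, so codimension
cannot grow. -/
theorem finrank_range_le_finrank_map_add {M N : Type*} [AddCommGroup M] [Module F M]
    [FiniteDimensional F M] [AddCommGroup N] [Module F N]
    (f : M →ₗ[F] N) (U : Submodule F M) :
    finrank F (LinearMap.range f) + finrank F U ≤ finrank F (U.map f) + finrank F M := by
  have h₁ := f.finrank_range_add_finrank_ker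
  have h₂ := finrank_comap_add_finrank_map (LinearMap.ker f).subtype f
    (LinearMap.ker f).injective_subtype (by simp) U
  have h₃ := Submodule.finrank_le (U.comap (LinearMap.ker f).subtype)
  omega

theorem finrank_le_finrank_map_add_finrank_ker {M N : Type*} [AddCommGroup M] [Module F M]
    [FiniteDimensional F M] [AddCommGroup N] [Module F N]
    (f : M →ₗ[F] N) (U : Submodule F M) :
    finrank F U ≤ finrank F (U.map f) + finrank F (LinearMap.ker f) := by
  have h₂ := finrank_comap_add_finrank_map (LinearMap.ker f).subtype f
    (LinearMap.ker f).injective_subtype (by simp) U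
  have h₃ := Submodule.finrank_le (U.comap (LinearMap.ker f).subtype)
  omega

theorem finrank_le_finrank_ker_add_one {M : Type*} [AddCommGroup M] [Module F M]
    [FiniteDimensional F M] (β : M →ₗ[F] F) :
    finrank F M ≤ finrank F (LinearMap.ker β) + 1 := by
  have h₁ := β.finrank_range_add_finrank_ker
  have h₂ := Submodule.finrank_le (LinearMap.range β)
  rw [finrank_self] at h₂
  omega

/-- Restricting a bilinear form to a hyperplane lowers its rank by at most two. -/
theorem finrank_range_le_finrank_range_restrict_add_two {W : Type*} [AddCommGroup W] [Module F W]
    [FiniteDimensional F W] (ω : W →ₗ[F] W →ₗ[F] F) (H : Submodule F W)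
    (hH : finrank F W ≤ finrank F H + 1) :
    finrank F (LinearMap.range ω) ≤
      finrank F (LinearMap.range (ω.compl₁₂ H.subtype H.subtype)) + 2 := by
  -- One dimension at most is lost by restricting the first argument to H (`h₁`), and one more by
  -- restricting the functionals, since the annihilator of H has dimension at most one (`h₂`).
  have h₁ := finrank_range_le_finrank_map_add ω H
  have h₂ := finrank_le_finrank_map_add_finrank_ker (M := Dual F W) H.subtype.dualMap (H.map ω)
  have h₄ := Subspace.finrank_add_finrank_dualAnnihilator_eq H
  have h₅ : LinearMap.ker H.subtype.dualMap = H.dualAnnihilator := by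
    rw [LinearMap.ker_dualMap_eq_dualAnnihilator_range, Submodule.range_subtype]
  have h₆ : (H.map ω).map H.subtype.dualMap =
      LinearMap.range (ω.compl₁₂ H.subtype H.subtype) := by
    ext φ
    constructor
    · rintro ⟨_, ⟨a, ha, rfl⟩, rfl⟩
      exact ⟨⟨a, ha⟩, rfl⟩
    · rintro ⟨a, rfl⟩
      exact ⟨ω a, ⟨a, a.2, rfl⟩, rfl⟩
  rw [h₅, h₆] at h₂
  have h₇ : finrank F (H.map ω) ≤ finrank F (LinearMap.range (ω.compl₁₂ H.subtype H.subtype)) +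
    finrank F H.dualAnnihilator := h₂
  omega

variable {W : Type*} [AddCommGroup W] [Module F W]

/-- The action of a square matrix on tuples of vectors. -/
def tupleAct {k : ℕ} (C : Matrix (Fin k) (Fin k) F) : (Fin k → W) →ₗ[F] (Fin k → W) where
  toFun X i := ∑ j, C i j • X j
  map_add' X Y := by ext i; simp [Finset.sum_add_distrib]
  map_smul' a X := by ext i; simp [Finset.smul_sum, smul_comm a]

theorem tupleAct_apply {k : ℕ} (C : Matrix (Fin k) (Fin k) F) (X : Fin k → W) (i : Fin k) :
    tupleAct C X i = ∑ j, C i j • X j := rfl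

theorem tupleAct_one {k : ℕ} (X : Fin k → W) :
    tupleAct (1 : Matrix (Fin k) (Fin k) F) X = X := by
  ext i
  simp [tupleAct_apply, Matrix.one_apply]

theorem tupleAct_mul {k : ℕ} (C C' : Matrix (Fin k) (Fin k) F) (X : Fin k → W) :
    tupleAct (C * C') X = tupleAct C (tupleAct C' X) := by
  ext i
  simp only [tupleAct_apply, Matrix.mul_apply, Finset.sum_smul, Finset.smul_sum, smul_smul]
  exact Finset.sum_comm

theorem comp_tupleAct {k : ℕ} (ℓ : W →ₗ[F] F) (C : Matrix (Fin k) (Fin k) F) (X : Fin k → W) :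
    ℓ ∘ tupleAct C X = C.mulVec (ℓ ∘ X) := by
  ext i
  simp [tupleAct_apply, Matrix.mulVec, dotProduct]

/-- Pulled back along e_i ↦ X_i, the form becomes a multiple of the determinant on F^k, with factor
f X. -/
theorem map_tupleAct_eq_zero {k : ℕ} (f : W [⋀^Fin k]→ₗ[F] F) (C : Matrix (Fin k) (Fin k) F)
    {X : Fin k → W} (h : f X = 0) : f (tupleAct C X) = 0 := by
  let g : (Fin k → F) →ₗ[F] W := Fintype.linearCombination F X
  have h₁ := (f.compLinearMap g).eq_smul_basis_det (Pi.basisFun F (Fin k))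
  have h₂ : (f.compLinearMap g) (Pi.basisFun F (Fin k)) = 0 := by
    rw [AlternatingMap.compLinearMap_apply, ← h]
    congr 1
    ext i
    simp [g, Fintype.linearCombination_apply, Pi.single_apply]
  rw [h₂, zero_smul] at h₁
  have h₃ := DFunLike.congr_fun h₁ C
  exact h₃

/-- An isomorphism between two lines of F^(k+1) extends to an automorphism of the whole space. -/
theorem exists_mulVec_eq_single {k : ℕ} {a : Fin (k + 1) → F} (ha : a ≠ 0) :
    ∃ C C' : Matrix (Fin (k + 1)) (Fin (k + 1)) F,
      C * C' = 1 ∧ C' * C = 1 ∧ C.mulVec a = Pi.single 0 1 := by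
  let e := LinearEquiv.toSpanNonzeroSingleton F (Fin (k + 1) → F) a ha
  have hs : (Pi.single 0 1 : Fin (k + 1) → F) ≠ 0 := by simp
  let e' := LinearEquiv.toSpanNonzeroSingleton F (Fin (k + 1) → F) _ hs
  obtain ⟨g, hg⟩ := Submodule.exists_linearEquiv_restrict_eq (e.symm.trans e')
  refine ⟨LinearMap.toMatrix' g.toLinearMap, LinearMap.toMatrix' g.symm.toLinearMap, ?_, ?_, ?_⟩
  · rw [← LinearMap.toMatrix'_comp]
    simp
  · rw [← LinearMap.toMatrix'_comp]
    simp
  · have h₁ := hg (e 1)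
    have h₂ : ((e 1 : F ∙ a) : Fin (k + 1) → F) = a := by
      simp [e]
    rw [h₂] at h₁
    rw [← Matrix.toLin'_apply, Matrix.toLin'_toMatrix', LinearEquiv.coe_coe, ← h₁]
    simp [e']

end LinearAlgebra

/-! ### Affine varieties annihilating Pfaffians -/

section Pfaffian

variable {F : Type*} [Field F] {W : Type*} [AddCommGroup W] [Module F W]

/-- The exterior product of a linear form with an alternating form. -/
def wedge {k : ℕ} (ℓ : W →ₗ[F] F) (f : W [⋀^Fin k]→ₗ[F] F) : W [⋀^Fin (k + 1)]→ₗ[F] F :=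
  AlternatingMap.alternatizeUncurryFin (LinearMap.smulRight ℓ f)

theorem wedge_apply {k : ℕ} (ℓ : W →ₗ[F] F) (f : W [⋀^Fin k]→ₗ[F] F) (v : Fin (k + 1) → W) :
    wedge ℓ f v = ∑ i : Fin (k + 1), (-1) ^ (i : ℕ) * (ℓ (v i) * f (i.removeNth v)) := by
  simp [wedge, AlternatingMap.alternatizeUncurryFin_apply]

theorem wedge_apply_eq_zero {k : ℕ} (ℓ : W →ₗ[F] F) (f : W [⋀^Fin k]→ₗ[F] F)
    {v : Fin (k + 1) → W} (h : ∀ i, ℓ (v i) = 0) : wedge ℓ f v = 0 := by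
  simp [wedge_apply, h]

theorem wedge_apply_of_tail {k : ℕ} (ℓ : W →ₗ[F] F) (f : W [⋀^Fin k]→ₗ[F] F)
    {v : Fin (k + 1) → W} (h : ∀ i : Fin k, ℓ (v i.succ) = 0) :
    wedge ℓ f v = ℓ (v 0) * f (Fin.tail v) := by
  simp [wedge_apply, Fin.sum_univ_succ, h]

/-- The even-degree members of `E` are the normalized exterior powers (Pfaffians) of the
bilinear form `ω`. -/
structure IsPfaffianFamily (ω : W →ₗ[F] W →ₗ[F] F) (E : ∀ k : ℕ, W [⋀^Fin k]→ₗ[F] F) : Prop where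
  zero : ∀ v, E 0 v = 1
  cons : ∀ k, Even k → ∀ (u : W) (v : Fin (k + 1) → W),
    E (k + 2) (Fin.cons u v) = wedge (ω u) (E k) v

/-- This lets the induction pass to the hyperplane ker ℓ. -/
theorem IsPfaffianFamily.comp {ω : W →ₗ[F] W →ₗ[F] F} {E : ∀ k : ℕ, W [⋀^Fin k]→ₗ[F] F}
    (h : IsPfaffianFamily ω E) {W' : Type*} [AddCommGroup W'] [Module F W'] (T : W' →ₗ[F] W) :
    IsPfaffianFamily (ω.compl₁₂ T T) (fun k => (E k).compLinearMap T) where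
  zero v := h.zero _
  cons k hk u v := by
    have h₁ := h.cons k hk (T u) (fun i => T (v i))
    have h₂ : (fun i => T ((Fin.cons u v : Fin (k + 2) → W') i)) =
        Fin.cons (T u) (fun i => T (v i)) := by
      ext i
      cases i using Fin.cases <;> simp
    rw [AlternatingMap.compLinearMap_apply, h₂, h₁, wedge_apply, wedge_apply]
    rfl

theorem range_single_zero_eq_ker_tail {k : ℕ} :
    LinearMap.range (LinearMap.single F (fun _ : Fin (k + 1) => W) 0) =
      LinearMap.ker (LinearMap.funLeft F W (Fin.succ : Fin k → Fin (k + 1))) := by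
  ext v
  simp only [LinearMap.mem_range, LinearMap.mem_ker]
  constructor
  · rintro ⟨x, rfl⟩
    ext i
    simp [LinearMap.funLeft_apply]
  · intro h
    refine ⟨v 0, ?_⟩
    ext i
    cases i using Fin.cases with
    | zero => simp
    | succ i => simpa [LinearMap.funLeft_apply] using (congrFun h i).symm

variable [FiniteDimensional F W]

theorem finrank_comap_single_add_finrank_map_tail {k : ℕ} (V : Submodule F (Fin (k + 1) → W)) :
    finrank F (V.comap (LinearMap.single F (fun _ : Fin (k + 1) => W) 0)) +
      finrank F (V.map (LinearMap.funLeft F W (Fin.succ : Fin k → Fin (k + 1)))) =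
        finrank F V :=
  finrank_comap_add_finrank_map _ _ (fun x y h => by simpa using congrFun h 0)
    range_single_zero_eq_ker_tail V

/-- The bound for varieties annihilating an even Pfaffian form. -/
def EvenBound (W : Type*) [AddCommGroup W] [Module F W] (k : ℕ) : Prop :=
  ∀ (ω : W →ₗ[F] W →ₗ[F] F) (E : ∀ k : ℕ, W [⋀^Fin k]→ₗ[F] F), IsPfaffianFamily ω E →
    k + 2 ≤ finrank F (LinearMap.range ω) → ∀ (A : Fin k → W) (V : Submodule F (Fin k → W)),
      (∀ v ∈ V, E k (A + v) = 0) → finrank F V + k < k * finrank F W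

/-- If a large variety annihilating `ℓ ∧ E k` passes through a tuple on which `ℓ` takes the values
`1, 0, …, 0`, then its codimension is exactly `k + 1`, it maps onto `F ^ (k + 1)` under `ℓ`, and the
first entry can be varied freely in `ker ℓ`. -/
theorem large_of_comp_eq_single {k : ℕ} {ω : W →ₗ[F] W →ₗ[F] F}
    {E : ∀ k : ℕ, W [⋀^Fin k]→ₗ[F] F} (hE : IsPfaffianFamily ω E) (ℓ : W →ₗ[F] F)
    (hk : EvenBound (F := F) (LinearMap.ker ℓ) k)
    (hω : k + 2 ≤ finrank F (LinearMap.range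
      (ω.compl₁₂ (LinearMap.ker ℓ).subtype (LinearMap.ker ℓ).subtype)))
    (A : Fin (k + 1) → W) (V : Submodule F (Fin (k + 1) → W))
    (hV : ∀ v ∈ V, wedge ℓ (E k) (A + v) = 0) (hA : ℓ ∘ A = Pi.single 0 1)
    (hle : (k + 1) * finrank F W ≤ finrank F V + (k + 1)) :
    finrank F V + (k + 1) = (k + 1) * finrank F W ∧ V.map (ℓ.compLeft (Fin (k + 1))) = ⊤ ∧
      ∀ x, ℓ x = 0 → (Pi.single 0 x : Fin (k + 1) → W) ∈ V := by
  set H := LinearMap.ker ℓ with hH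
  have hA' : ∀ i, ℓ (A i) = (Pi.single 0 1 : Fin (k + 1) → F) i := fun i => congrFun hA i
  have hA0 : ℓ (A 0) = 1 := by simpa using hA' 0
  have hAs : ∀ i : Fin k, ℓ (A i.succ) = 0 := fun i => by simpa using hA' i.succ
  have hn : finrank F H + 1 = finrank F W := by
    have h₁ := ℓ.finrank_range_add_finrank_ker
    have h₂ : LinearMap.range ℓ = ⊤ :=
      LinearMap.range_eq_top.2 (LinearMap.surjective fun h => by simp [h] at hA0)
    rw [h₂, finrank_top, finrank_self, ← hH] at h₁
    omega
  -- Directions in `V₀` keep the ℓ-values 1, 0, …, 0, so along them the wedge collapses to `E k` of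
  -- the tail, and the even bound on ker ℓ applies to the tails.
  set V₀ := V.comap (H.subtype.compLeft (Fin (k + 1))) with hV₀
  have h₁ : finrank F V₀ + finrank F (V.map (ℓ.compLeft (Fin (k + 1)))) = finrank F V := by
    refine finrank_comap_add_finrank_map _ _ ?_ ?_ V
    · intro x y hxy
      ext i
      exact congrFun hxy i
    · ext v
      constructor
      · rintro ⟨x, rfl⟩
        ext i
        exact (x i).2
      · intro h
        exact ⟨fun i => ⟨v i, congrFun h i⟩, rfl⟩
  have h₂ := finrank_comap_single_add_finrank_map_tail V₀
  have h₃ := hk _ _ (hE.comp H.subtype) hω (fun i => ⟨A i.succ, hAs i⟩)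
    (V₀.map (LinearMap.funLeft F H (Fin.succ : Fin k → Fin (k + 1)))) (by
      rintro _ ⟨v, hv, rfl⟩
      have h₄ := hV _ hv
      rw [wedge_apply_of_tail] at h₄
      · have h₅ : ℓ (v 0 : W) = 0 := (v 0).2
        simp only [Pi.add_apply, map_add, hA0, LinearMap.compLeft_apply, Function.comp_apply,
          Submodule.subtype_apply, h₅, add_zero, one_mul] at h₄
        exact h₄
      · intro i
        have h₅ : ℓ (v i.succ : W) = 0 := (v i.succ).2
        simp [hAs, h₅])
  have h₄ := Submodule.finrank_le (V₀.comap (LinearMap.single F (fun _ : Fin (k + 1) => H) 0))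
  have h₅ := Submodule.finrank_le (V.map (ℓ.compLeft (Fin (k + 1))))
  rw [finrank_fin_fun] at h₅
  have h₆ : (k + 1) * finrank F W = k * finrank F H + finrank F H + k + 1 := by
    rw [← hn]; ring
  -- With h = dim H the count is dim V ≤ h + (kh − k − 1) + (k + 1) = (k + 1)h = (k + 1) dim W − (k
  -- + 1). By `hle` every inequality used is an equality.
  refine ⟨by omega, ?_, ?_⟩
  · apply Submodule.eq_top_of_finrank_eq
    rw [finrank_fin_fun]
    omega
  · intro x hx
    have h₇ : V₀.comap (LinearMap.single F (fun _ : Fin (k + 1) => H) 0) = ⊤ :=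
      Submodule.eq_top_of_finrank_eq (by omega)
    have h₈ : (⟨x, hx⟩ : H) ∈ V₀.comap (LinearMap.single F (fun _ : Fin (k + 1) => H) 0) := by
      rw [h₇]; trivial
    have h₉ : (Pi.single 0 x : Fin (k + 1) → W) =
        H.subtype.compLeft (Fin (k + 1)) (Pi.single 0 ⟨x, hx⟩) := by
      ext i
      cases i using Fin.cases <;> simp
    rw [h₉]
    exact h₈

/-- Column operations move the nonzero vector ℓ ∘ A to the first unit vector and preserve both
dimension and annihilation. -/
theorem large_of_comp_ne_zero {k : ℕ} {ω : W →ₗ[F] W →ₗ[F] F}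
    {E : ∀ k : ℕ, W [⋀^Fin k]→ₗ[F] F} (hE : IsPfaffianFamily ω E) (ℓ : W →ₗ[F] F)
    (hk : EvenBound (F := F) (LinearMap.ker ℓ) k)
    (hω : k + 2 ≤ finrank F (LinearMap.range
      (ω.compl₁₂ (LinearMap.ker ℓ).subtype (LinearMap.ker ℓ).subtype)))
    (A : Fin (k + 1) → W) (V : Submodule F (Fin (k + 1) → W))
    (hV : ∀ v ∈ V, wedge ℓ (E k) (A + v) = 0) (hA : ℓ ∘ A ≠ 0)
    (hle : (k + 1) * finrank F W ≤ finrank F V + (k + 1)) :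
    finrank F V + (k + 1) = (k + 1) * finrank F W ∧ V.map (ℓ.compLeft (Fin (k + 1))) = ⊤ ∧
      ∀ x, ℓ x = 0 → (fun i => ℓ (A i) • x) ∈ V := by
  obtain ⟨C, C', hC, hC', ha⟩ := exists_mulVec_eq_single hA
  have hinv : ∀ X : Fin (k + 1) → W, tupleAct C' (tupleAct C X) = X := fun X => by
    rw [← tupleAct_mul, hC', tupleAct_one]
  have hfin : finrank F (V.map (tupleAct C)) = finrank F V :=
    (LinearEquiv.finrank_eq (Submodule.equivMapOfInjective (tupleAct C)
      (Function.LeftInverse.injective hinv) V)).symm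
  obtain ⟨h₁, h₂, h₃⟩ := large_of_comp_eq_single hE ℓ hk hω (tupleAct C A) (V.map (tupleAct C)) (by
      rintro _ ⟨v, hv, rfl⟩
      rw [← map_add]
      exact map_tupleAct_eq_zero _ _ (hV v hv)) (by rw [comp_tupleAct, ha]) (by rwa [hfin])
  rw [hfin] at h₁
  refine ⟨h₁, ?_, ?_⟩
  · rw [eq_top_iff]
    rintro b -
    have hb : C.mulVec b ∈ (V.map (tupleAct C)).map (ℓ.compLeft (Fin (k + 1))) := by
      rw [h₂]; trivial
    obtain ⟨_, ⟨v, hv, rfl⟩, hvb⟩ := hb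
    refine ⟨v, hv, ?_⟩
    have h₄ : C.mulVec (ℓ ∘ v) = C.mulVec b := by rw [← comp_tupleAct]; exact hvb
    have h₅ := congrArg C'.mulVec h₄
    simp only [Matrix.mulVec_mulVec, hC', Matrix.one_mulVec] at h₅
    exact h₅
  · intro x hx
    obtain ⟨v, hv, hvx⟩ := h₃ x hx
    have h₄ : v = fun i => ℓ (A i) • x := by
      rw [← hinv v, hvx]
      ext i
      -- The first column of `C'` is ℓ ∘ A, so undoing the column operations sends (x, 0, …, 0) to
      -- the tuple with entries ℓ(A i) • x.
      have h₅ : C'.mulVec (Pi.single 0 1) = ℓ ∘ A := by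
        rw [← ha, Matrix.mulVec_mulVec, hC', Matrix.one_mulVec]
      have h₆ := congrFun h₅ i
      simp only [Matrix.mulVec_single_one, Matrix.col_apply, Function.comp_apply] at h₆
      simp [tupleAct_apply, Fin.sum_univ_succ, h₆]
    rwa [← h₄]

/-- A variety annihilating `ℓ ∧ E k` lies in the kernel of `ℓ` or has codimension greater than
`k + 1`. -/
theorem odd_bound {k : ℕ} {ω : W →ₗ[F] W →ₗ[F] F}
    {E : ∀ k : ℕ, W [⋀^Fin k]→ₗ[F] F} (hE : IsPfaffianFamily ω E) (ℓ : W →ₗ[F] F)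
    (hk : EvenBound (F := F) (LinearMap.ker ℓ) k)
    (hω : k + 2 ≤ finrank F (LinearMap.range
      (ω.compl₁₂ (LinearMap.ker ℓ).subtype (LinearMap.ker ℓ).subtype)))
    (A : Fin (k + 1) → W) (V : Submodule F (Fin (k + 1) → W))
    (hV : ∀ v ∈ V, wedge ℓ (E k) (A + v) = 0) :
    (∀ v ∈ V, ∀ i, ℓ ((A + v) i) = 0) ∨ finrank F V + (k + 1) < (k + 1) * finrank F W := by
  by_contra! hcon
  obtain ⟨⟨v₀, hv₀, i₀, hi₀⟩, hle⟩ := hcon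
  have hshift : ∀ w ∈ V, ∀ v ∈ V, wedge ℓ (E k) (A + w + v) = 0 := fun w hw v hv => by
    rw [add_assoc]; exact hV _ (V.add_mem hw hv)
  obtain ⟨h₁, h₂, -⟩ := large_of_comp_ne_zero hE ℓ hk hω (A + v₀) V (hshift v₀ hv₀)
    (fun h => hi₀ (congrFun h i₀)) hle
  have hsurj : ∀ b : Fin (k + 1) → F, ∃ v ∈ V, ℓ ∘ v = b := fun b => by
    have hb : b ∈ V.map (ℓ.compLeft (Fin (k + 1))) := by rw [h₂]; trivial
    exact hb
  have hsingle : ∀ i x, ℓ x = 0 → (Pi.single i x : Fin (k + 1) → W) ∈ V := by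
    intro i x hx
    -- Moving the base point within the variety makes its ℓ-values the i-th unit vector, which
    -- places the free direction in entry i.
    obtain ⟨v, hv, hvb⟩ := hsurj (Pi.single i 1 - ℓ ∘ A)
    have h₃ : ∀ j, ℓ ((A + v) j) = (Pi.single i 1 : Fin (k + 1) → F) j := fun j => by
      have := congrFun hvb j
      simp only [Function.comp_apply, Pi.sub_apply] at this
      simp [this]
    obtain ⟨-, -, h₄⟩ := large_of_comp_ne_zero hE ℓ hk hω (A + v) V (hshift v hv)
      (fun h => by simpa using (h₃ i).symm.trans (congrFun h i)) hle
    have h₅ := h₄ x hx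
    convert h₅ using 1
    ext j
    rw [h₃]
    by_cases hj : j = i
    · subst hj; simp
    · simp [hj]
  -- V contains all tuples in ker ℓ and surjects onto the ℓ-values, so it is everything, against
  -- codimension k + 1 > 0.
  have htop : V = ⊤ := by
    rw [eq_top_iff]
    rintro X -
    obtain ⟨v, hv, hvX⟩ := hsurj (ℓ ∘ X)
    have h₃ : X - v ∈ V := by
      rw [← Finset.univ_sum_single (X - v)]
      refine V.sum_mem fun i _ => hsingle i _ ?_
      have := congrFun hvX i
      simp only [Function.comp_apply] at this
      simp [this]
    simpa using V.add_mem h₃ hv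
  rw [htop, finrank_top, finrank_pi_fintype] at h₁
  simp at h₁

/-- A large variety annihilating `E (k + 2)` is invariant under changes of its first entry. -/
theorem single_zero_mem_of_large {k : ℕ} (hk : Even k)
    (hb : ∀ H : Submodule F W, EvenBound (F := F) H k) {ω : W →ₗ[F] W →ₗ[F] F}
    {E : ∀ k : ℕ, W [⋀^Fin k]→ₗ[F] F} (hE : IsPfaffianFamily ω E)
    (hω : k + 4 ≤ finrank F (LinearMap.range ω))
    (A : Fin (k + 2) → W) (V : Submodule F (Fin (k + 2) → W))
    (hV : ∀ v ∈ V, E (k + 2) (A + v) = 0)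
    (hle : (k + 2) * finrank F W ≤ finrank F V + (k + 2)) (x : W) :
    (Pi.single 0 x : Fin (k + 2) → W) ∈ V := by
  set U := V.comap (LinearMap.single F (fun _ : Fin (k + 2) => W) 0) with hU
  set P := V.map (LinearMap.funLeft F W (Fin.succ : Fin (k + 1) → Fin (k + 2))) with hP
  have h₁ : finrank F U + finrank F P = finrank F V := finrank_comap_single_add_finrank_map_tail V
  suffices hT : U = ⊤ by
    have hx : x ∈ U := by rw [hT]; trivial
    exact hx
  by_contra hT
  have hlt : finrank F U < finrank F W := Submodule.finrank_lt hT
  -- Adding u to the first entry changes `E (k + 2)` by (ω u ∧ E k)(tail), which therefore vanishes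
  -- on the tails. As dim U < dim W, their codimension is at most k + 1, so `odd_bound` leaves only
  -- its first alternative.
  have hann : ∀ u ∈ U, ∀ p ∈ P, ∀ i, ω u (p i) = 0 := by
    intro u hu
    have hw : ∀ p ∈ P, wedge (ω u) (E k) (Fin.tail A + p) = 0 := by
      rintro _ ⟨v, hv, rfl⟩
      rw [← hE.cons k hk]
      have h₂ := hV v hv
      have h₃ := hV (v + Pi.single 0 u) (V.add_mem hv (show Pi.single 0 u ∈ V from hu))
      have h₄ : A + v = Fin.cons ((A + v) 0) (Fin.tail (A + v)) := (Fin.cons_self_tail _).symm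
      have h₅ : A + (v + Pi.single 0 u) = Fin.cons ((A + v) 0 + u) (Fin.tail (A + v)) := by
        ext i
        cases i using Fin.cases <;> simp [Fin.tail, add_assoc]
      have h₆ := (E (k + 2)).toMultilinearMap.cons_add (Fin.tail (A + v)) ((A + v) 0) u
      simp only [AlternatingMap.coe_multilinearMap] at h₆
      rw [← h₅, h₃, ← h₄, h₂, zero_add] at h₆
      exact h₆.symm
    rcases odd_bound hE (ω u) (hb _) (by
      have := finrank_range_le_finrank_range_restrict_add_two ω (LinearMap.ker (ω u))
        (finrank_le_finrank_ker_add_one (ω u))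
      omega) (Fin.tail A) P hw with h | h
    · intro p hp i
      have h₂ := h p hp i
      have h₃ := h 0 P.zero_mem i
      simp only [Pi.add_apply, map_add, Pi.zero_apply, add_zero] at h₂ h₃
      rwa [h₃, zero_add] at h₂
    · exfalso
      have h₂ : (k + 2) * finrank F W = (k + 1) * finrank F W + finrank F W := by ring
      omega
  -- Let n = dim W and q = dim ω(U). Then dim P ≤ (k + 1)(n − q) and dim U ≤ q + n − (k + 4). The
  -- sum is at most (k + 2)n − kq − k − 4, below the assumed (k + 2)n − (k + 2).
  have hcoann := Subspace.finrank_add_finrank_dualCoannihilator_eq (K := F) (V := W) (U.map ω)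
  have hPle : finrank F P ≤ (k + 1) * finrank F (Submodule.dualCoannihilator (U.map ω)) := by
    let N := Submodule.dualCoannihilator (U.map ω)
    have h₂ : P ≤ LinearMap.range (N.subtype.compLeft (Fin (k + 1))) := by
      intro p hp
      refine ⟨fun i => ⟨p i, ?_⟩, rfl⟩
      rw [Submodule.mem_dualCoannihilator]
      rintro _ ⟨u, hu, rfl⟩
      exact hann u hu p hp i
    have h₃ := (Submodule.finrank_mono h₂).trans (LinearMap.finrank_range_le _)
    rw [finrank_pi_fintype, Finset.sum_const, Finset.card_univ, Fintype.card_fin,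
      smul_eq_mul] at h₃
    exact h₃
  have hrank := finrank_range_le_finrank_map_add ω U
  have hcoann' : finrank F (U.map ω) + finrank F (Submodule.dualCoannihilator (U.map ω)) =
    finrank F W := hcoann
  generalize finrank F (Submodule.dualCoannihilator (U.map ω)) = d at *
  generalize finrank F (U.map ω) = q at *
  generalize finrank F U = a at *
  generalize finrank F P = p at *
  generalize finrank F W = n at *
  subst hcoann'
  rcases Nat.lt_or_ge q 2 with hq | hq
  · interval_cases q <;> nlinarith
  · nlinarith

/-- In degree 0 the form is the constant 1. Otherwise symmetry extends the freedom of the first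
entry to every entry, so a large variety is the whole space. -/
theorem even_bound {k : ℕ} (hk : Even k) : ∀ (W : Type*) [AddCommGroup W] [Module F W]
    [FiniteDimensional F W], EvenBound (F := F) W k := by
  induction k using Nat.twoStepInduction with
  | zero =>
    intro W _ _ _ ω E hE _ A V hV
    have := hV 0 V.zero_mem
    rw [hE.zero] at this
    exact absurd this one_ne_zero
  | one => exact absurd hk (by decide)
  | more k ih _ =>
    have hk' : Even k := by simpa [Nat.even_add] using hk
    intro W _ _ _ ω E hE hω A V hV
    by_contra! hle
    have hmem : ∀ i x, (Pi.single i x : Fin (k + 2) → W) ∈ V := by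
      intro i x
      let σ := Equiv.swap 0 i
      let e := LinearEquiv.funCongrLeft F W σ
      have h₁ := single_zero_mem_of_large hk' (fun H => ih hk' H) hE hω (e A) (V.map e.toLinearMap)
        (by
          rintro _ ⟨v, hv, rfl⟩
          have h₂ : e A + e v = (A + v) ∘ σ := rfl
          rw [LinearEquiv.coe_coe, h₂, AlternatingMap.map_perm, hV v hv, smul_zero])
        (by rwa [LinearEquiv.finrank_map_eq]) x
      obtain ⟨v, hv, hvx⟩ := h₁
      suffices h : Pi.single i x = v by rw [h]; exact hv
      ext j
      have h₃ := congrFun hvx (σ.symm j)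
      simp only [LinearEquiv.coe_coe, e, LinearEquiv.funCongrLeft_apply, LinearMap.funLeft_apply,
        Equiv.apply_symm_apply] at h₃
      rw [h₃]
      by_cases hj : j = i
      · subst hj; simp [σ]
      · have : σ.symm j ≠ 0 := by
          intro h
          rw [Equiv.symm_apply_eq] at h
          simp [σ] at h
          exact hj h
        simp [hj, this]
    have htop : V = ⊤ := by
      rw [eq_top_iff]
      rintro X -
      rw [← Finset.univ_sum_single X]
      exact V.sum_mem fun i _ => hmem i _
    -- Now `E (k + 2)` vanishes identically, hence so does ω u ∧ E k; since the whole space has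
    -- codimension 0, `odd_bound` forces ω u = 0.
    obtain ⟨u, hu⟩ : ∃ u, ω u ≠ 0 := by
      by_contra! h
      have : ω = 0 := LinearMap.ext h
      rw [this, LinearMap.range_zero, finrank_bot] at hω
      omega
    rcases odd_bound hE (ω u) (ih hk' _) (by
      have := finrank_range_le_finrank_range_restrict_add_two ω (LinearMap.ker (ω u))
        (finrank_le_finrank_ker_add_one (ω u))
      omega) 0 ⊤ (by
        intro v _
        rw [← hE.cons k hk']
        have := hV (Fin.cons u (0 + v) - A) (by rw [htop]; trivial)
        rwa [add_sub_cancel] at this) with h | h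
    · refine hu (LinearMap.ext fun x => ?_)
      simpa using h (fun _ => x) trivial 0
    · rw [finrank_top, finrank_pi_fintype] at h
      simp only [Finset.sum_const, Finset.card_univ, Fintype.card_fin, smul_eq_mul] at h
      omega

end Pfaffian

/-! ### Sums of maximal minors as Pfaffians -/

section MinorSum

variable {F : Type*} [Field F] {n : ℕ}

/-- Alternating forms on `Fⁿ` agree if they agree on strictly increasing tuples of unit vectors. -/
theorem alternatingMap_ext_strictMono {k : ℕ} {f g : (Fin n → F) [⋀^Fin k]→ₗ[F] F}
    (h : ∀ τ : Fin k → Fin n, StrictMono τ →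
      f (fun i => Pi.single (τ i) 1) = g (fun i => Pi.single (τ i) 1)) : f = g := by
  refine Basis.ext_alternating (Pi.basisFun F (Fin n)) fun τ hτ => ?_
  have hs : StrictMono (τ ∘ Tuple.sort τ) :=
    (Tuple.monotone_sort τ).strictMono_of_injective (hτ.comp (Tuple.sort τ).injective)
  have h₁ : ∀ q : (Fin n → F) [⋀^Fin k]→ₗ[F] F, q (fun i => Pi.basisFun F (Fin n) (τ i)) =
      Equiv.Perm.sign (Tuple.sort τ)⁻¹ •
        q (fun i => Pi.single ((τ ∘ Tuple.sort τ) i) 1) := by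
    intro q
    rw [← AlternatingMap.map_perm]
    congr 1
    ext i
    simp
  rw [h₁, h₁, h _ hs]

variable (F n) in
/-- The sum of all maximal minors of the matrix with the given columns. -/
noncomputable def minorSum (k : ℕ) : (Fin n → F) [⋀^Fin k]→ₗ[F] F :=
  ∑ c : {c : Finset (Fin n) // c.card = k},
    Matrix.detRowAlternating.compLinearMap (LinearMap.funLeft F F (c.1.orderEmbOfFin c.2))

theorem minorSum_apply {k : ℕ} (v : Fin k → Fin n → F) :
    minorSum F n k v = ∑ c : {c : Finset (Fin n) // c.card = k},
      Matrix.det (Matrix.of fun i j => v i (c.1.orderEmbOfFin c.2 j)) := by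
  let ev : ((Fin n → F) [⋀^Fin k]→ₗ[F] F) →+ F :=
    { toFun := fun f => f v, map_zero' := rfl, map_add' := fun _ _ => rfl }
  exact map_sum ev _ _

/-- Only the minor on the rows τ survives, and its matrix is the identity. -/
theorem minorSum_single_of_strictMono {k : ℕ} {τ : Fin k → Fin n} (hτ : StrictMono τ) :
    minorSum F n k (fun i => Pi.single (τ i) 1) = 1 := by
  have hc : (Finset.univ.image τ).card = k := by
    rw [Finset.card_image_of_injective _ hτ.injective, Finset.card_univ, Fintype.card_fin]
  rw [minorSum_apply, Fintype.sum_eq_single ⟨Finset.univ.image τ, hc⟩]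
  · have h₁ : τ = (Finset.univ.image τ).orderEmbOfFin hc :=
      Finset.orderEmbOfFin_unique hc (fun i => Finset.mem_image_of_mem τ (Finset.mem_univ i)) hτ
    have h₂ : (Matrix.of fun i j => (Pi.single (τ i) 1 : Fin n → F)
        ((Finset.univ.image τ).orderEmbOfFin hc j)) = 1 := by
      ext i j
      rw [← h₁]
      simp [Matrix.one_apply, Pi.single_apply, hτ.injective.eq_iff, eq_comm]
    rw [h₂, Matrix.det_one]
  · rintro ⟨c, hck⟩ hne
    obtain ⟨i, hi⟩ : ∃ i, τ i ∉ c := by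
      by_contra! h
      refine hne (Subtype.ext (Finset.eq_of_subset_of_card_le ?_ (by rw [hc, hck])).symm)
      intro x hx
      obtain ⟨i, -, rfl⟩ := Finset.mem_image.1 hx
      exact h i
    refine Matrix.det_eq_zero_of_row_eq_zero i fun j => ?_
    simp only [Matrix.of_apply]
    rw [Pi.single_eq_of_ne]
    intro h
    exact hi (h ▸ Finset.orderEmbOfFin_mem c hck j)

theorem sum_neg_one_pow_ite_lt {N q : ℕ} (hq : q ≤ N) :
    ∑ i : Fin N, (-1 : F) ^ (i : ℕ) * (if (i : ℕ) < q then 1 else 0) =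
      if Even q then 0 else 1 := by
  rw [← neg_one_geom_sum, Fin.sum_univ_eq_sum_range
    (fun i => (-1 : F) ^ i * (if i < q then 1 else 0)) N]
  simp only [mul_ite, mul_one, mul_zero]
  rw [← Finset.sum_filter]
  congr 1
  ext i
  simp only [Finset.mem_filter, Finset.mem_range]
  omega

theorem sum_neg_one_pow_of_odd {N : ℕ} (hN : Odd N) : ∑ i : Fin N, (-1 : F) ^ (i : ℕ) = 1 := by
  rw [Fin.sum_univ_eq_sum_range (fun i => (-1 : F) ^ i) N, neg_one_geom_sum,
    if_neg (Nat.not_even_iff_odd.2 hN)]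

theorem exists_iff_val_lt_of_isLowerSet {N : ℕ} (s : Set (Fin N)) (hs : IsLowerSet s) :
    ∃ q ≤ N, ∀ i : Fin N, i ∈ s ↔ (i : ℕ) < q := by
  classical
  by_cases h : ∃ q, ∃ hq : q < N, (⟨q, hq⟩ : Fin N) ∉ s
  · obtain ⟨hq, hqs⟩ := Nat.find_spec h
    refine ⟨Nat.find h, hq.le, fun i => ⟨fun hi => ?_, fun hi => ?_⟩⟩
    · by_contra! hle
      exact hqs (hs (show (⟨Nat.find h, hq⟩ : Fin N) ≤ i from hle) hi)
    · have := Nat.find_min h hi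
      push Not at this
      exact this i.2
  · push Not at h
    exact ⟨N, le_rfl, fun i => ⟨fun _ => i.2, fun _ => h i i.2⟩⟩

variable (F n) in
/-- The functional summing all entries. -/
def sumForm : (Fin n → F) →ₗ[F] F := ∑ i, LinearMap.proj i

theorem sumForm_apply (x : Fin n → F) : sumForm F n x = ∑ i, x i := by
  simp [sumForm]

variable (F n) in
/-- The bilinear form with `(e_r, e_s) ↦ 1` for `r < s` and `(e_r, e_s) ↦ -1` for `s < r`. -/
def signForm : (Fin n → F) →ₗ[F] (Fin n → F) →ₗ[F] F :=
  Matrix.toLinearMap₂' F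
    (Matrix.of fun r s : Fin n => 1 - (if s < r then 1 else 0) - (if s ≤ r then 1 else 0))

theorem signForm_single (r s : Fin n) :
    signForm F n (Pi.single r 1) (Pi.single s 1) =
      1 - (if s < r then 1 else 0) - (if s ≤ r then 1 else 0) := by
  rw [signForm, Matrix.toLinearMap₂'_apply']
  simp

theorem removeNth_single {k : ℕ} (τ : Fin (k + 1) → Fin n) (i : Fin (k + 1)) :
    i.removeNth (fun j => (Pi.single (τ j) 1 : Fin n → F)) =
      fun j => Pi.single ((τ ∘ i.succAbove) j) 1 := rfl

/-- On increasing unit vectors this is the identity 1 − 1 + ⋯ + 1 = 1 with k + 1 terms. -/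
theorem minorSum_succ_of_even {k : ℕ} (hk : Even k) :
    minorSum F n (k + 1) = wedge (sumForm F n) (minorSum F n k) := by
  refine alternatingMap_ext_strictMono fun τ hτ => ?_
  rw [minorSum_single_of_strictMono hτ, wedge_apply]
  refine (sum_neg_one_pow_of_odd hk.add_one).symm.trans (Finset.sum_congr rfl fun i _ => ?_)
  rw [removeNth_single, minorSum_single_of_strictMono (hτ.comp (Fin.strictMono_succAbove i))]
  simp [sumForm_apply]

/-- Let q and q' count the entries of τ that are < r and ≤ r. The right side is 1 − [q odd] − [q'
odd]. If r occurs in τ, then q' = q + 1 and both sides vanish. Otherwise q' = q and both sides are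
(−1)^q, the sign of moving r to its place. -/
theorem minorSum_cons_single {k : ℕ} (hk : Even k) {τ : Fin (k + 1) → Fin n} (hτ : StrictMono τ)
    (r : Fin n) : minorSum F n (k + 2) (Fin.cons (Pi.single r 1) fun i => Pi.single (τ i) 1) =
      wedge (signForm F n (Pi.single r 1)) (minorSum F n k) (fun i => Pi.single (τ i) 1) := by
  obtain ⟨q, hq, hqs⟩ := exists_iff_val_lt_of_isLowerSet {i | τ i < r}
    (fun a b hab ha => lt_of_le_of_lt (hτ.monotone hab) ha)
  obtain ⟨q', hq', hqs'⟩ := exists_iff_val_lt_of_isLowerSet {i | τ i ≤ r}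
    (fun a b hab ha => le_trans (hτ.monotone hab) ha)
  simp only [Set.mem_ofPred_eq] at hqs hqs'
  have hR : wedge (signForm F n (Pi.single r 1)) (minorSum F n k) (fun i => Pi.single (τ i) 1) =
      1 - (if Even q then 0 else 1) - (if Even q' then 0 else 1) := by
    refine Eq.trans ?_ (congrArg
      (fun x : F => x - (if Even q then 0 else 1) - (if Even q' then 0 else 1))
      (sum_neg_one_pow_of_odd (F := F) hk.add_one))
    rw [wedge_apply, ← sum_neg_one_pow_ite_lt (F := F) hq, ← sum_neg_one_pow_ite_lt (F := F) hq',
      ← Finset.sum_sub_distrib, ← Finset.sum_sub_distrib]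
    refine Finset.sum_congr rfl fun i _ => ?_
    rw [removeNth_single, minorSum_single_of_strictMono (hτ.comp (Fin.strictMono_succAbove i)),
      signForm_single]
    simp only [hqs, hqs']
    ring
  rw [hR]
  by_cases hr : ∃ i, τ i = r
  · obtain ⟨i, rfl⟩ := hr
    have h₁ : q = i := by
      simp only [hτ.lt_iff_lt] at hqs
      by_contra hne
      rcases lt_or_gt_of_ne hne with h | h
      · have := (hqs ⟨q, h.trans i.2⟩).1 h
        simp at this
      · simpa using (hqs i).2 h
    have h₂ : q' = i + 1 := by
      simp only [hτ.le_iff_le] at hqs'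
      have h₃ := (hqs' i).1 le_rfl
      by_contra hne
      have h₄ : (i : ℕ) + 1 < q' := by omega
      have h₅ := (hqs' ⟨i + 1, by omega⟩).2 h₄
      rw [Fin.le_def] at h₅
      simp at h₅
    rw [(minorSum F n (k + 2)).map_eq_zero_of_eq _ (i := 0) (j := i.succ) (by simp)
      (Fin.succ_ne_zero i).symm, h₁, h₂]
    by_cases h : Even (i : ℕ) <;> simp [h, Nat.even_add_one]
  · push Not at hr
    have h₁ : q' = q := by
      have h₂ : ∀ i : Fin (k + 1), (i : ℕ) < q' ↔ (i : ℕ) < q := fun i => by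
        rw [← hqs, ← hqs']
        exact ⟨fun h => lt_of_le_of_ne h (hr i), le_of_lt⟩
      by_contra hne
      rcases lt_or_gt_of_ne hne with h | h
      · have := (h₂ ⟨q', by omega⟩).2 h
        simp at this
      · have := (h₂ ⟨q, by omega⟩).1 h
        simp at this
    have h₂ := (minorSum F n (k + 2)).neg_one_pow_smul_map_insertNth ⟨q, by omega⟩ (Pi.single r 1)
      (fun i => Pi.single (τ i) 1)
    have h₃ : (Fin.insertNth (⟨q, by omega⟩ : Fin (k + 2)) (Pi.single r 1)
        (fun i => Pi.single (τ i) 1) : Fin (k + 2) → Fin n → F) =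
        fun i => Pi.single
          ((Fin.insertNth (⟨q, by omega⟩ : Fin (k + 2)) r τ : Fin (k + 2) → Fin n) i) 1 := by
      ext i : 1
      refine Fin.succAboveCases (⟨q, by omega⟩ : Fin (k + 2)) ?_ (fun j => ?_) i <;> simp
    have h₄ : StrictMono (Fin.insertNth (⟨q, by omega⟩ : Fin (k + 2)) r τ :
        Fin (k + 2) → Fin n) := by
      intro a b
      refine Fin.succAboveCases (⟨q, by omega⟩ : Fin (k + 2)) ?_ (fun a => ?_) a <;>
        refine Fin.succAboveCases (⟨q, by omega⟩ : Fin (k + 2)) ?_ (fun b => ?_) b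
      · simp
      · intro h
        rw [Fin.lt_succAbove_iff_le_castSucc, Fin.le_def] at h
        have h₅ := (not_congr (hqs b)).2 (by simpa using h)
        simpa using lt_of_le_of_ne (not_lt.1 h₅) (hr b).symm
      · intro h
        rw [Fin.succAbove_lt_iff_castSucc_lt, Fin.lt_def] at h
        simpa using (hqs a).2 (by simpa using h)
      · intro h
        simpa using hτ ((Fin.strictMono_succAbove _).lt_iff_lt.1 h)
    rw [h₃, minorSum_single_of_strictMono h₄] at h₂
    change minorSum F n (k + 2) (Matrix.vecCons _ _) = _
    rw [← h₂]
    subst h₁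
    rcases Nat.even_or_odd q' with h | h
    · simp [h]
    · simp [Nat.not_even_iff_odd.2 h, h.neg_one_pow]

theorem isPfaffianFamily_minorSum : IsPfaffianFamily (signForm F n) (minorSum F n) where
  zero v := by
    have h := minorSum_single_of_strictMono (F := F) (n := n) (k := 0) (τ := Fin.elim0)
      (fun a => a.elim0)
    rw [← h]
    congr 1
    exact Subsingleton.elim _ _
  cons k hk u v := by
    let G : (Fin n → F) →ₗ[F] (Fin n → F) [⋀^Fin (k + 1)]→ₗ[F] F :=
      { toFun := fun u => wedge (signForm F n u) (minorSum F n k)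
        map_add' := fun x y => by
          ext v
          simp [wedge_apply, add_mul, mul_add, Finset.sum_add_distrib]
        map_smul' := fun a x => by
          ext v
          simp [wedge_apply, Finset.mul_sum, mul_assoc, mul_left_comm] }
    have h : (minorSum F n (k + 2)).curryLeft = G := by
      refine (Pi.basisFun F (Fin n)).ext fun r => alternatingMap_ext_strictMono fun τ hτ => ?_
      rw [Pi.basisFun_apply]
      exact minorSum_cons_single hk hτ r
    exact DFunLike.congr_fun (DFunLike.congr_fun h u) v

end MinorSum

/-! ### Rank of the sign form -/

section Rank

variable {F : Type*} [Field F] {n : ℕ}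

theorem signForm_apply_single (x : Fin n → F) (s : Fin n) :
    signForm F n x (Pi.single s 1) =
      ∑ r, x r * (1 - (if s < r then 1 else 0) - (if s ≤ r then 1 else 0)) := by
  rw [signForm, Matrix.toLinearMap₂'_apply']
  simp [dotProduct]

/-- The unit vectors at s and s + 1 pair equally with every e_r except r = s and r = s + 1. Hence
radical vectors alternate in sign and are determined by their first entry. -/
theorem signForm_apply_single_succ_sub_single (x : Fin (n + 1) → F) (s : Fin n) :
    signForm F (n + 1) x (Pi.single s.succ 1 - Pi.single s.castSucc 1) =
      x s.castSucc + x s.succ := by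
  have h : ∀ r : Fin (n + 1), x r * (1 - (if s.succ < r then 1 else 0) -
      (if s.succ ≤ r then 1 else 0)) - x r * (1 - (if s.castSucc < r then 1 else 0) -
      (if s.castSucc ≤ r then 1 else 0)) =
      (if r = s.castSucc then x r else 0) + (if r = s.succ then x r else 0) := by
    intro r
    have h₁ : s.succ ≤ r ↔ s.castSucc < r := Fin.castSucc_lt_iff_succ_le.symm
    rcases lt_trichotomy r s.castSucc with h | h | h
    · have h₂ : ¬ s.castSucc < r := h.not_gt
      have h₃ : ¬ s.succ < r := fun h' => h₂ (h₁.1 h'.le)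
      have h₄ : r ≠ s.succ := fun h' => h₂ (h₁.1 h'.ge)
      simp [h₁, h₂, h₃, h₄, h.ne, h.not_ge]
    · subst h
      have h₃ : ¬ s.succ < s.castSucc := fun h' => lt_irrefl _ (h₁.1 h'.le)
      have h₄ : s.castSucc ≠ s.succ := Fin.castSucc_lt_succ.ne
      simp [h₃, h₄]
    · rcases (h₁.2 h).eq_or_lt with h' | h'
      · subst h'
        simp [h, h.le, h.ne']
      · simp [h₁, h, h.le, h.ne', h', h'.ne']
  rw [map_sub, signForm_apply_single, signForm_apply_single, ← Finset.sum_sub_distrib,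
    Finset.sum_congr rfl fun r _ => h r, Finset.sum_add_distrib]
  simp

theorem apply_eq_neg_one_pow_mul {x : Fin (n + 1) → F}
    (hx : ∀ s : Fin n, x s.castSucc + x s.succ = 0) (i : Fin (n + 1)) :
    x i = (-1) ^ (i : ℕ) * x 0 := by
  induction i using Fin.induction with
  | zero => simp
  | succ i ih =>
    rw [eq_neg_of_add_eq_zero_right (hx i), ih, Fin.val_succ, pow_succ, Fin.val_castSucc]
    ring

theorem finrank_le_one_of_alternating {N : Type*} [AddCommGroup N] [Module F N]
    [FiniteDimensional F N] (f : N →ₗ[F] (Fin (n + 1) → F)) (hf : Function.Injective f)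
    (h : ∀ y (s : Fin n), f y s.castSucc + f y s.succ = 0) : finrank F N ≤ 1 := by
  have h₁ : Function.Injective (LinearMap.proj 0 ∘ₗ f) := by
    rw [injective_iff_map_eq_zero]
    intro y hy
    apply hf
    rw [map_zero]
    ext i
    have h₂ : f y 0 = 0 := hy
    simp [apply_eq_neg_one_pow_mul (h y) i, h₂]
  simpa using LinearMap.finrank_le_finrank_of_injective h₁

theorem sum_apply_of_alternating {x : Fin (n + 1) → F}
    (hx : ∀ s : Fin n, x s.castSucc + x s.succ = 0) :
    ∑ i, x i = if Even (n + 1) then 0 else x 0 := by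
  rw [Finset.sum_congr rfl fun i _ => apply_eq_neg_one_pow_mul hx i, ← Finset.sum_mul,
    Fin.sum_univ_eq_sum_range (fun i => (-1 : F) ^ i), neg_one_geom_sum]
  split_ifs <;> simp

/-- The radical has dimension at most 1, which suffices for n > k + 2. For n = k + 2 even, an
alternating vector has sum 0, and pairing it with e_0 gives its first entry, so the radical is 0. -/
theorem le_finrank_range_signForm {k : ℕ} (hk : Even k) (hn : k + 2 ≤ n) :
    k + 2 ≤ finrank F (LinearMap.range (signForm F n)) := by
  obtain ⟨n, rfl⟩ : ∃ m, n = m + 1 := ⟨n - 1, by omega⟩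
  have h₁ := (signForm F (n + 1)).finrank_range_add_finrank_ker
  rw [finrank_fin_fun] at h₁
  have halt : ∀ y : LinearMap.ker (signForm F (n + 1)), ∀ s : Fin n,
      (y : Fin (n + 1) → F) s.castSucc + (y : Fin (n + 1) → F) s.succ = 0 := fun y s => by
    rw [← signForm_apply_single_succ_sub_single, LinearMap.mem_ker.1 y.2, LinearMap.zero_apply]
  rcases hn.eq_or_lt with h | h
  · have hbot : LinearMap.ker (signForm F (n + 1)) = ⊥ := by
      rw [LinearMap.ker_eq_bot']
      intro x hx
      have hx' : ∀ s : Fin n, x s.castSucc + x s.succ = 0 := halt ⟨x, hx⟩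
      have h₂ : signForm F (n + 1) x (Pi.single 0 1) = 0 := by rw [hx, LinearMap.zero_apply]
      rw [signForm_apply_single] at h₂
      have h₃ : ∑ r, x r * (1 - (if 0 < r then 1 else 0) - (if 0 ≤ r then 1 else 0)) =
          x 0 - ∑ r, x r := by
        rw [Fin.sum_univ_succ, Fin.sum_univ_succ]
        simp
      have heven : Even (n + 1) := by rw [← h]; exact hk.add even_two
      rw [h₃, sum_apply_of_alternating hx', if_pos heven, sub_zero] at h₂
      ext i
      simp [apply_eq_neg_one_pow_mul hx' i, h₂]
    rw [hbot, finrank_bot] at h₁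
    omega
  · have := finrank_le_one_of_alternating (LinearMap.ker (signForm F (n + 1))).subtype
      (Submodule.injective_subtype _) halt
    omega

/-- The test vectors e_{s+1} − e_s lie in the hyperplane, so the radical is again at most a line. In
the tight case n = k + 3 is odd, and an alternating vector with sum 0 is 0. -/
theorem le_finrank_range_signForm_restrict {k : ℕ} (hk : Even k) (hn : k + 3 ≤ n) :
    k + 2 ≤ finrank F (LinearMap.range ((signForm F n).compl₁₂
      (LinearMap.ker (sumForm F n)).subtype (LinearMap.ker (sumForm F n)).subtype)) := by
  obtain ⟨n, rfl⟩ : ∃ m, n = m + 1 := ⟨n - 1, by omega⟩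
  set H := LinearMap.ker (sumForm F (n + 1)) with hH
  set ω := (signForm F (n + 1)).compl₁₂ H.subtype H.subtype with hω
  have h₁ := ω.finrank_range_add_finrank_ker
  have h₂ := finrank_le_finrank_ker_add_one (sumForm F (n + 1))
  rw [finrank_fin_fun, ← hH] at h₂
  have halt : ∀ y : LinearMap.ker ω, ∀ s : Fin n,
      (y : Fin (n + 1) → F) s.castSucc + (y : Fin (n + 1) → F) s.succ = 0 := fun y s => by
    rw [← signForm_apply_single_succ_sub_single]
    have h₃ : (Pi.single s.succ 1 - Pi.single s.castSucc 1 : Fin (n + 1) → F) ∈ H := by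
      rw [hH, LinearMap.mem_ker, map_sub, sumForm_apply, sumForm_apply]
      simp
    exact DFunLike.congr_fun (LinearMap.mem_ker.1 y.2) ⟨_, h₃⟩
  rcases hn.eq_or_lt with h | h
  · have hbot : LinearMap.ker ω = ⊥ := by
      rw [LinearMap.ker_eq_bot']
      intro x hx
      have hx' : ∀ s : Fin n, (x : Fin (n + 1) → F) s.castSucc +
        (x : Fin (n + 1) → F) s.succ = 0 := halt ⟨x, hx⟩
      have h₃ : ∑ i, (x : Fin (n + 1) → F) i = 0 := by rw [← sumForm_apply]; exact x.2
      have hodd : ¬ Even (n + 1) := by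
        rw [← h, Nat.not_even_iff_odd]; exact hk.add_odd (by decide)
      rw [sum_apply_of_alternating hx', if_neg hodd] at h₃
      ext i
      rw [apply_eq_neg_one_pow_mul hx' i]
      simp [h₃]
    rw [hbot, finrank_bot] at h₁
    omega
  · have := finrank_le_one_of_alternating (N := LinearMap.ker ω)
      (H.subtype ∘ₗ (LinearMap.ker ω).subtype)
      ((Submodule.injective_subtype _).comp (Submodule.injective_subtype _)) halt
    omega

end Rank

/-! ### From the Cullis determinant to the minor sum -/

section Det

variable {F : Type*} [Field F] {n k : ℕ}

/-- An injection as a subset together with a permutation. -/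
noncomputable def imageAndPerm (σ : Fin k ↪ Fin n) :
    {c : Finset (Fin n) // c.card = k} × Equiv.Perm (Fin k) :=
  (⟨image σ, card_image σ⟩,
    (toImage σ).trans ((image σ).orderIsoOfFin (card_image σ)).symm.toEquiv)

theorem orderEmbOfFin_imageAndPerm (σ : Fin k ↪ Fin n) (i : Fin k) :
    (image σ).orderEmbOfFin (card_image σ) ((imageAndPerm σ).2 i) = σ i := by
  simp [imageAndPerm, Finset.orderEmbOfFin]
  rfl

theorem bijective_imageAndPerm : Function.Bijective (imageAndPerm (n := n) (k := k)) := by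
  constructor
  · intro σ τ h
    ext i
    rw [← orderEmbOfFin_imageAndPerm σ, ← orderEmbOfFin_imageAndPerm τ, h]
    have h₁ : image σ = image τ := congrArg (fun p => p.1.1) h
    congr 3
  · rintro ⟨⟨c, hc⟩, π⟩
    let σ : Fin k ↪ Fin n := π.toEmbedding.trans (c.orderEmbOfFin hc).toEmbedding
    have h₁ : image σ = c := by
      apply Finset.eq_of_subset_of_card_le
      · intro x hx
        obtain ⟨i, -, rfl⟩ := Finset.mem_map.1 hx
        exact Finset.orderEmbOfFin_mem c hc _
      · rw [card_image, hc]
    refine ⟨σ, Prod.ext (Subtype.ext h₁) (Equiv.ext fun i => ?_)⟩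
    apply (c.orderEmbOfFin hc).injective
    have h₂ := orderEmbOfFin_imageAndPerm σ i
    have h₃ : (image σ).orderEmbOfFin (card_image σ) = c.orderEmbOfFin hc := by
      congr
    rw [h₃] at h₂
    exact h₂

theorem sign_imagePerm (σ : Fin k ↪ Fin n) :
    Equiv.Perm.sign (imagePerm σ) = Equiv.Perm.sign (imageAndPerm σ).2 := by
  rw [← Equiv.Perm.sign_permCongr ((image σ).orderIsoOfFin (card_image σ)).toEquiv
    (imageAndPerm σ).2]
  congr 1
  ext x
  simp [imagePerm, imageAndPerm, Equiv.permCongr_apply]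

/-- The first product depends only on k; the second is absorbed by the row signs in `signedColumns`.
-/
theorem setSign_eq (c : Finset (Fin n)) (hc : c.card = k) :
    setSign c hc = (∏ α : Fin k, (-1) ^ (α : ℕ)) *
      ∏ α : Fin k, (-1) ^ (c.orderEmbOfFin hc α : ℕ) := by
  have h : ∀ (s : Finset (Fin k)) (f : Fin k → ℤ),
      ((-1 : ℤˣ)) ^ (∑ α ∈ s, f α) = ∏ α ∈ s, (-1) ^ f α := by
    intro s f
    induction s using Finset.induction_on with
    | empty => simp
    | insert a s ha ih => rw [Finset.sum_insert ha, Finset.prod_insert ha, zpow_add, ih]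
  rw [setSign, h, ← Finset.prod_mul_distrib]
  refine Finset.prod_congr rfl fun α _ => ?_
  rw [zpow_sub, zpow_natCast, zpow_natCast, mul_comm, Int.units_inv_eq_self]

variable (F n k) in
/-- A matrix as the tuple of its columns, with alternating signs in the rows. -/
def signedColumns : Matrix (Fin n) (Fin k) F ≃ₗ[F] (Fin k → Fin n → F) where
  toFun X j i := (-1) ^ (i : ℕ) * X i j
  invFun Y := Matrix.of fun i j => (-1) ^ (i : ℕ) * Y j i
  map_add' X Y := by ext; simp [mul_add]
  map_smul' a X := by ext; simp [mul_left_comm]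
  left_inv X := by ext; simp [← mul_assoc, ← mul_pow]
  right_inv X := by ext; simp [← mul_assoc, ← mul_pow]

theorem signedColumns_apply (X : Matrix (Fin n) (Fin k) F) (j : Fin k) (i : Fin n) :
    signedColumns F n k X j i = (-1) ^ (i : ℕ) * X i j := rfl

/-- Grouping injections by image turns each group into the Leibniz expansion of one maximal minor.
-/
theorem det_eq_minorSum (X : Matrix (Fin n) (Fin k) F) :
    det X = (∏ α : Fin k, (-1) ^ (α : ℕ)) * minorSum F n k (signedColumns F n k X) := by
  let g : {c : Finset (Fin n) // c.card = k} × Equiv.Perm (Fin k) → F := fun p =>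
    ((Equiv.Perm.sign p.2 : ℤ) : F) *
      ∏ i, signedColumns F n k X i (p.1.1.orderEmbOfFin p.1.2 (p.2 i))
  have h₁ : minorSum F n k (signedColumns F n k X) = ∑ σ : Fin k ↪ Fin n, g (imageAndPerm σ) := by
    rw [bijective_imageAndPerm.sum_comp g, Fintype.sum_prod_type, minorSum_apply]
    refine Finset.sum_congr rfl fun c _ => ?_
    rw [← Matrix.det_transpose, Matrix.det_apply']
    rfl
  rw [h₁, det, Finset.mul_sum]
  refine Finset.sum_congr rfl fun σ _ => ?_
  have h₂ : ∏ i, (-1 : F) ^ (σ i : ℕ) =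
      ∏ α, (-1 : F) ^ ((image σ).orderEmbOfFin (card_image σ) α : ℕ) := by
    refine Eq.trans ?_ (Equiv.prod_comp (imageAndPerm σ).2 fun α =>
      (-1 : F) ^ ((image σ).orderEmbOfFin (card_image σ) α : ℕ))
    simp only [orderEmbOfFin_imageAndPerm]
  have h₃ : g (imageAndPerm σ) = ((Equiv.Perm.sign (imageAndPerm σ).2 : ℤ) : F) *
      ∏ i, signedColumns F n k X i (σ i) := by
    refine congrArg _ (Finset.prod_congr rfl fun i _ => ?_)
    exact congrArg _ (orderEmbOfFin_imageAndPerm σ i)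
  simp only [h₃, signedColumns_apply, Finset.prod_mul_distrib, h₂, injSign, sign_imagePerm,
    setSign_eq]
  push_cast
  ring

theorem det_eq_zero_iff (X : Matrix (Fin n) (Fin k) F) :
    det X = 0 ↔ minorSum F n k (signedColumns F n k X) = 0 := by
  rw [det_eq_minorSum, mul_eq_zero, or_iff_right]
  exact Finset.prod_ne_zero_iff.2 fun α _ => pow_ne_zero _ (neg_ne_zero.2 one_ne_zero)

theorem mem_altRowSumZero_iff (X : Matrix (Fin n) (Fin k) F) :
    X ∈ altRowSumZero F n k ↔ ∀ j, sumForm F n (signedColumns F n k X j) = 0 := by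
  change altRowSum X = 0 ↔ _
  rw [funext_iff]
  refine forall_congr' fun j => ?_
  -- The exponents i + 1 in `altRowSum` and i in `signedColumns` differ by a global sign.
  rw [sumForm_apply, ← neg_eq_zero]
  simp [altRowSum, signedColumns_apply, pow_succ]

theorem finrank_altRowSumZero (hn : 0 < n) : finrank F (altRowSumZero F n k) + k = k * n := by
  obtain ⟨n, rfl⟩ : ∃ m, n = m + 1 := ⟨n - 1, by omega⟩
  let f : Matrix (Fin (n + 1)) (Fin k) F →ₗ[F] (Fin k → F) :=
    (sumForm F (n + 1)).compLeft (Fin k) ∘ₗ (signedColumns F (n + 1) k).toLinearMap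
  have h₁ : altRowSumZero F (n + 1) k = LinearMap.ker f := by
    ext X
    rw [mem_altRowSumZero_iff, LinearMap.mem_ker, funext_iff]
    rfl
  have h₂ : LinearMap.range f = ⊤ := by
    rw [LinearMap.range_eq_top]
    intro b
    refine ⟨(signedColumns F (n + 1) k).symm fun j => Pi.single 0 (b j), ?_⟩
    ext j
    simp [f, sumForm_apply]
  have h₃ := f.finrank_range_add_finrank_ker
  rw [← h₁, h₂, finrank_top, finrank_fin_fun, finrank_matrix] at h₃
  simp only [Fintype.card_fin, finrank_self, mul_one] at h₃
  rw [mul_comm k, ← h₃, add_comm]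

end Det

/-! ### Annihilating varieties of the Cullis determinant -/

section Main

variable {F : Type*} [Field F] {n k : ℕ}

theorem minorSum_add_eq_zero {K : AffineSubspace F (Matrix (Fin n) (Fin k) F)}
    (hdet : ∀ X ∈ K, det X = 0) {A : Matrix (Fin n) (Fin k) F} (hA : A ∈ K) :
    ∀ v ∈ K.direction.map (signedColumns F n k).toLinearMap,
      minorSum F n k (signedColumns F n k A + v) = 0 := by
  rintro _ ⟨v, hv, rfl⟩
  rw [LinearEquiv.coe_coe, ← map_add, ← det_eq_zero_iff, add_comm]
  exact hdet _ (AffineSubspace.vadd_mem_of_mem_direction hv hA)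

theorem finrank_add_lt_of_even (hk : Even k) (hn : k + 2 ≤ n)
    {K : AffineSubspace F (Matrix (Fin n) (Fin k) F)} (hK : IsAnnihilating K) :
    finrank F K.direction + k < k * n := by
  obtain ⟨⟨A, hA⟩, hdet⟩ := hK
  have h := even_bound (F := F) hk (Fin n → F) _ _ isPfaffianFamily_minorSum
    (le_finrank_range_signForm hk hn) _ _ (minorSum_add_eq_zero hdet hA)
  rwa [LinearEquiv.finrank_map_eq, finrank_fin_fun] at h

/-- This is the dichotomy of `odd_bound` for ℓ = `sumForm`, whose vanishing on all signed columns
defines L. -/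
theorem le_altRowSumZero_or_finrank_add_lt_of_odd (hk : Odd k) (hn : k + 2 ≤ n)
    {K : AffineSubspace F (Matrix (Fin n) (Fin k) F)} (hK : IsAnnihilating K) :
    K ≤ (altRowSumZero F n k).toAffineSubspace ∨ finrank F K.direction + k < k * n := by
  obtain ⟨⟨A, hA⟩, hdet⟩ := hK
  obtain ⟨k, rfl⟩ : ∃ m, k = m + 1 := ⟨k - 1, by have := hk.pos; omega⟩
  have hk' : Even k := by simpa [Nat.odd_add_one] using hk
  have hV := minorSum_add_eq_zero hdet hA
  rw [minorSum_succ_of_even hk'] at hV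
  rcases odd_bound isPfaffianFamily_minorSum (sumForm F n) (even_bound hk' _)
    (le_finrank_range_signForm_restrict hk' (by omega)) _ _ hV with h | h
  · left
    intro X hX
    rw [Submodule.mem_toAffineSubspace, mem_altRowSumZero_iff]
    have := h _ ⟨X - A, AffineSubspace.vsub_mem_direction hX hA, rfl⟩
    rwa [LinearEquiv.coe_coe, ← map_add, add_sub_cancel] at this
  · right
    rwa [LinearEquiv.finrank_map_eq, finrank_fin_fun] at h

theorem isAnnihilating_altRowSumZero (hk : Odd k) :
    IsAnnihilating (altRowSumZero F n k).toAffineSubspace := by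
  refine ⟨⟨0, (altRowSumZero F n k).zero_mem⟩, fun X hX => ?_⟩
  obtain ⟨k, rfl⟩ : ∃ m, k = m + 1 := ⟨k - 1, by have := hk.pos; omega⟩
  have hk' : Even k := by simpa [Nat.odd_add_one] using hk
  rw [det_eq_zero_iff, minorSum_succ_of_even hk']
  exact wedge_apply_eq_zero _ _ ((mem_altRowSumZero_iff X).1 hX)

theorem dim_altRowSumZero (hn : 0 < n) :
    dim (altRowSumZero F n k).toAffineSubspace + k = k * n := by
  rw [dim, Submodule.toAffineSubspace_direction]
  exact finrank_altRowSumZero hn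

/-- Codimension at most k excludes the second alternative, and containment in L with at least its
dimension forces equality. -/
theorem eq_altRowSumZero_of_odd (hk : Odd k) (hn : k + 2 ≤ n)
    {K : AffineSubspace F (Matrix (Fin n) (Fin k) F)} (hK : IsAnnihilating K)
    (hle : k * n ≤ dim K + k) : K = (altRowSumZero F n k).toAffineSubspace := by
  rcases le_altRowSumZero_or_finrank_add_lt_of_odd hk hn hK with h | h
  · refine AffineSubspace.eq_of_direction_eq_of_nonempty_of_le ?_ hK.1 h
    apply Submodule.eq_of_le_of_finrank_le (AffineSubspace.direction_le h)
    have := dim_altRowSumZero (F := F) (n := n) (k := k) (by omega)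
    rw [dim] at this hle
    omega
  · rw [dim] at hle
    omega

end Main

end Cullis

theorem mainTheorem1 {F : Type*} [Field F] {n k : ℕ} (hnk : k + 2 ≤ n) :
    (∀ K : AffineSubspace F (Matrix (Fin n) (Fin k) F),
        (K : Set (Matrix (Fin n) (Fin k) F)).Nonempty →
        (((∀ X ∈ K, Cullis.det X = 0) ∧ Cullis.codim K = k) ↔
          (Odd k ∧ K = (Cullis.altRowSumZero F n k).toAffineSubspace))) ∧
    (Odd k → ∀ K : AffineSubspace F (Matrix (Fin n) (Fin k) F),
        Cullis.IsMaxAnnihilating K ↔ K = (Cullis.altRowSumZero F n k).toAffineSubspace) ∧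
    (Even k → ∀ K : AffineSubspace F (Matrix (Fin n) (Fin k) F),
        Cullis.IsAnnihilating K → k < Cullis.codim K) := by
  have hL := Cullis.dim_altRowSumZero (F := F) (n := n) (k := k) (by omega)
  have heven : Even k → ∀ K : AffineSubspace F (Matrix (Fin n) (Fin k) F),
      Cullis.IsAnnihilating K → k < Cullis.codim K := by
    intro hk K hK
    have h := Cullis.finrank_add_lt_of_even hk hnk hK
    rw [Cullis.codim, Cullis.dim, mul_comm n k]
    omega
  refine ⟨fun K hne => ⟨fun ⟨hdet, hcodim⟩ => ?_, ?_⟩, fun hk K => ⟨fun hK => ?_, ?_⟩, heven⟩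
  · rcases Nat.even_or_odd k with hk | hk
    · exact absurd (heven hk K ⟨hne, hdet⟩) (by omega)
    · refine ⟨hk, Cullis.eq_altRowSumZero_of_odd hk hnk ⟨hne, hdet⟩ ?_⟩
      rw [Cullis.codim, mul_comm n k] at hcodim
      omega
  · rintro ⟨hk, rfl⟩
    refine ⟨(Cullis.isAnnihilating_altRowSumZero hk).2, ?_⟩
    rw [Cullis.codim, mul_comm n k]
    omega
  · refine Cullis.eq_altRowSumZero_of_odd hk hnk hK.1 ?_
    have := hK.2 _ (Cullis.isAnnihilating_altRowSumZero hk)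
    omega
  · rintro rfl
    refine ⟨Cullis.isAnnihilating_altRowSumZero hk, fun K' hK' => ?_⟩
    by_contra! hlt
    have h := Cullis.eq_altRowSumZero_of_odd hk hnk hK' (by omega)
    rw [h] at hlt
    exact lt_irrefl _ hlt
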